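/- For $k\in\mathbb{C}$ define $$\varphi(k)=1-k+\frac{\pi}{2}\int_{0}^{\infty}\operatorname{csch}^2\!\Big(\frac{\pi u}{2}\Big)\Big(1-(1+u^2)^{k/2}\cos(k\arctan u)\Big)\,du .$$ The trivial zeros of $\zeta$ are the negative even integers. Call the positive odd integers and the points $1+2\pi i j/\log 2$ ($j\in\mathbb{Z}$) the trivial zeros of $\varphi$. A zero of $\zeta$, respectively of $\varphi$, that is not trivial is called non-trivial. Write $k!=\Gamma(k+1)$. Theorem. The integral converges absolutely for every $k\in\mathbb{C}$, and $\varphi$ is an entire function. Moreover: 1. For every $k\in\mathbb{C}$ other than $1$ and the negative integers, $$-2\,k!\,\big(2^{1-k}-1\big)\,\pi^{-k}\cos\!\Big(\frac{\pi k}{2}\Big)\,\zeta(k)=\varphi(k).$$ 2. For every $k\in\mathbb{C}\setminus\{1\}$, $$2(k-1)\big(1-2^{-k}\big)\zeta(k)=\varphi(1-k).$$ 3. The trivial zeros of $\varphi$ are indeed zeros of $\varphi$. A complex number $k$ is a non-trivial zero of $\zeta$ if and only if it is a non-trivial zero of $\varphi$. The non-trivial zeros of $\varphi$ are exactly the zeros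 of $\varphi$ with $0<\Re(k)<1$. 4. The Riemann hypothesis holds if and only if every zero $k$ of $\varphi$ with $0<\Re(k)<1$ satisfies $\Re(k)=\tfrac12$. -/

import Mathlib

noncomputable section

/-- The integrand in the definition of `varphi`, at a complex parameter `k` and a real `u > 0`;
`csch x` is written `(sinh x)⁻¹`, and the power is that of the positive real base `1 + u ^ 2`. -/
def varphiIntegrand (k : ℂ) (u : ℝ) : ℂ :=
  (((Real.sinh (Real.pi * u / 2))⁻¹ ^ 2 : ℝ) : ℂ) *
    (1 - ((1 + u ^ 2 : ℝ) : ℂ) ^ (k / 2) * Complex.cos (k * (Real.arctan u : ℂ)))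

/-- `φ(k) = 1 - k + (π / 2) ∫₀^∞ csch²(π u / 2) (1 - (1 + u²)^(k/2) cos (k arctan u)) du`. -/
def varphi (k : ℂ) : ℂ :=
  1 - k + (Real.pi / 2 : ℂ) * ∫ u in Set.Ioi (0 : ℝ), varphiIntegrand k u

/-- Non-trivial zeros of the Riemann zeta function: the zeros that are not negative even integers.
The pole `1`, where Mathlib's `riemannZeta` takes a conventional value, is not a zero. -/
def IsNontrivialZetaZero (k : ℂ) : Prop :=
  k ≠ 1 ∧ riemannZeta k = 0 ∧ ¬ ∃ n : ℕ, k = -2 * ((n : ℂ) + 1)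

/-- Trivial zeros of `φ`: the positive odd integers, and the points `1 + 2 π i j / log 2`
for integer `j`. -/
def IsTrivialVarphiPoint (k : ℂ) : Prop :=
  (∃ n : ℕ, k = 2 * (n : ℂ) + 1) ∨
    ∃ j : ℤ, k = 1 + 2 * (Real.pi : ℂ) * Complex.I * (j : ℂ) / ((Real.log 2 : ℝ) : ℂ)

/-- Non-trivial zeros of `φ`: its zeros other than the trivial ones. -/
def IsNontrivialVarphiZero (k : ℂ) : Prop :=
  varphi k = 0 ∧ ¬ IsTrivialVarphiPoint k

end

/-! For `0 < a.re`, the factor `1 - (1 + u²)^(-a/2) cos(a arctan u)` times `Γ(a)` is the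
Laplace-type integral of `t^(a-1) e^(-t) (1 - cos ut)`. Swapping the integrals leaves the cosine
transform of `csch²(πu/2)`, which equals `(2/π)(t coth t - 1)`. The terms `1 - k = 1 + a` of `φ(-a)`
turn this into the Mellin transform of `1/sinh t` at `a + 1`, a Dirichlet series over odd integers,
so that `φ(-a)` is `ζ(a + 1)` times elementary factors (`varphi_neg_eq`).

As `φ` is entire, the identity theorem extends this to all `k ≠ 1` (`varphi_one_sub`), and the
functional equation of `ζ` converts it to the form with `ζ(k)` (`varphi_eq_Gamma_mul`). The zeros of
`φ` are then read off: the second identity, with the classical zero-free regions of `ζ`, confines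
the non-trivial ones to the open strip, where the elementary factors of the first identity do not
vanish. -/

open Complex MeasureTheory Filter Topology Set

/-! ### Parameter integrals and the Laplace transform of powers -/

/-- Holomorphy of an integral depending holomorphically on a parameter, the integrand being
dominated near the point. -/
theorem differentiableAt_integral_of_dominated_ball {α : Type*} [MeasurableSpace α]
    {μ : Measure α} {F : ℂ → α → ℂ} {z₀ : ℂ} {r : ℝ} {bound : α → ℝ} (hr : 0 < r)
    (hF_meas : ∀ z ∈ Metric.ball z₀ r, AEStronglyMeasurable (F z) μ)
    (h_diff : ∀ᵐ a ∂μ, DifferentiableOn ℂ (F · a) (Metric.ball z₀ r))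
    (h_bound : ∀ᵐ a ∂μ, ∀ z ∈ Metric.ball z₀ r, ‖F z a‖ ≤ bound a)
    (bound_integrable : Integrable bound μ) :
    DifferentiableAt ℂ (fun z ↦ ∫ a, F z a ∂μ) z₀ := by
  have hz₀ : z₀ ∈ Metric.ball z₀ r := Metric.mem_ball_self hr
  have hderiv : ∀ᵐ a ∂μ, ∀ z ∈ Metric.ball z₀ r, HasDerivAt (F · a) (deriv (F · a) z) z := by
    filter_upwards [h_diff] with a ha z hz
    exact (ha.differentiableAt (Metric.isOpen_ball.mem_nhds hz)).hasDerivAt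
  have hsub : Metric.ball z₀ (r / 2) ⊆ Metric.ball z₀ r := Metric.ball_subset_ball (by linarith)
  -- The derivative is measurable in `a` as a limit of difference quotients along a sequence tending
  -- to `z₀`.
  have hmeas' : AEStronglyMeasurable (fun a ↦ deriv (F · a) z₀) μ := by
    obtain ⟨v, -, hv0, hv⟩ : ∃ v : ℕ → ℝ, StrictAnti v ∧ (∀ n, v n ∈ Ioo 0 r) ∧
        Tendsto v atTop (𝓝 0) := exists_seq_strictAnti_tendsto' hr
    have hvz : Tendsto (fun n ↦ z₀ + (v n : ℂ)) atTop (𝓝[≠] z₀) := by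
      refine tendsto_nhdsWithin_iff.2 ⟨?_, .of_forall fun n ↦ ?_⟩
      · simpa using tendsto_const_nhds.add ((continuous_ofReal.tendsto 0).comp hv)
      · simpa using (hv0 n).1.ne'
    refine aestronglyMeasurable_of_tendsto_ae atTop
      (f := fun n a ↦ slope (F · a) z₀ (z₀ + v n)) (fun n ↦ ?_) ?_
    · simp only [slope_def_module]
      refine AEStronglyMeasurable.const_smul ((hF_meas _ ?_).sub (hF_meas _ hz₀)) (_ : ℂ)
      simpa [abs_of_pos (hv0 n).1] using (hv0 n).2
    · filter_upwards [hderiv] with a ha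
      exact (hasDerivAt_iff_tendsto_slope.1 (ha z₀ hz₀)).comp hvz
  -- Cauchy's estimate: around a point of the ball of radius `r / 2`, circles of radius `r / 4` stay
  -- in the ball where `F` is bounded.
  refine (hasDerivAt_integral_of_dominated_loc_of_deriv_le (F := F)
    (F' := fun z a ↦ deriv (F · a) z) (bound := fun a ↦ bound a / (r / 4))
    (Metric.ball_mem_nhds z₀ (half_pos hr)) ?_ ?_ hmeas' ?_ (bound_integrable.div_const _)
    ?_).2.differentiableAt
  · filter_upwards [Metric.ball_mem_nhds z₀ hr] using hF_meas
  · refine bound_integrable.mono' (hF_meas _ hz₀) ?_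
    filter_upwards [h_bound] with a ha using ha _ hz₀
  · filter_upwards [h_diff, h_bound] with a ha hb z hz
    have hcb : Metric.closedBall z (r / 4) ⊆ Metric.ball z₀ r := by
      intro w hw
      have h1 := Metric.mem_closedBall.1 hw
      have h2 := Metric.mem_ball.1 hz
      have := dist_triangle w z z₀
      exact Metric.mem_ball.2 (by linarith)
    refine norm_deriv_le_of_forall_mem_sphere_norm_le (by linarith) ?_ fun w hw ↦
      hb w (hcb (Metric.sphere_subset_closedBall hw))
    exact ha.diffContOnCl_ball hcb
  · filter_upwards [hderiv] with a ha z hz using ha z (hsub hz)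

theorem integrableOn_rpow_mul_exp_neg_mul {p b : ℝ} (hp : 0 < p) (hb : 0 < b) :
    IntegrableOn (fun t : ℝ ↦ t ^ (p - 1) * Real.exp (-(b * t))) (Ioi 0) := by
  simpa using integrableOn_rpow_mul_exp_neg_mul_rpow (s := p - 1) (p := 1) (b := b)
    (by linarith) one_pos hb

theorem norm_ofReal_cpow_mul_exp_neg {a r : ℂ} {t : ℝ} (ht : 0 < t) :
    ‖(t : ℂ) ^ (a - 1) * cexp (-(r * t))‖ = t ^ (a.re - 1) * Real.exp (-(r.re * t)) := by
  simp [norm_cpow_eq_rpow_re_of_pos ht, norm_exp]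

theorem aestronglyMeasurable_cpow_mul_exp_neg (a r : ℂ) :
    AEStronglyMeasurable (fun t : ℝ ↦ (t : ℂ) ^ (a - 1) * cexp (-(r * t)))
      (volume.restrict (Ioi 0)) := by
  refine ContinuousOn.aestronglyMeasurable (fun t ht ↦ ?_) measurableSet_Ioi
  refine ContinuousAt.continuousWithinAt (ContinuousAt.mul ?_ (by fun_prop))
  exact continuousAt_ofReal_cpow_const _ _ (Or.inr (ne_of_gt ht))

theorem integrableOn_cpow_mul_exp_neg {a r : ℂ} (ha : 0 < a.re) (hr : 0 < r.re) :
    IntegrableOn (fun t : ℝ ↦ (t : ℂ) ^ (a - 1) * cexp (-(r * t))) (Ioi 0) := by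
  refine (integrableOn_rpow_mul_exp_neg_mul ha hr).mono'
    (aestronglyMeasurable_cpow_mul_exp_neg a r) ?_
  filter_upwards [ae_restrict_mem measurableSet_Ioi] with t ht
  rw [norm_ofReal_cpow_mul_exp_neg ht]

theorem differentiableAt_integral_cpow_mul_exp_neg {a r : ℂ} (ha : 0 < a.re) (hr : 0 < r.re) :
    DifferentiableAt ℂ (fun r : ℂ ↦ ∫ t in Ioi (0 : ℝ), (t : ℂ) ^ (a - 1) * cexp (-(r * t))) r := by
  refine differentiableAt_integral_of_dominated_ball (half_pos hr)
    (fun z _ ↦ aestronglyMeasurable_cpow_mul_exp_neg a z) (.of_forall fun t ↦ by fun_prop) ?_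
    (integrableOn_rpow_mul_exp_neg_mul ha (half_pos hr))
  filter_upwards [ae_restrict_mem measurableSet_Ioi] with t (ht : 0 < t) z hz
  rw [norm_ofReal_cpow_mul_exp_neg ht]
  have h1 : r.re / 2 ≤ z.re := by
    have := (abs_le.1 ((abs_re_le_norm (z - r)).trans (mem_ball_iff_norm.1 hz).le)).1
    simp at this
    linarith
  gcongr

/-- The Laplace transform of `t ^ (a - 1)` on the right half-plane. -/
theorem integral_cpow_mul_exp_neg_mul {a r : ℂ} (ha : 0 < a.re) (hr : 0 < r.re) :
    ∫ t in Ioi (0 : ℝ), (t : ℂ) ^ (a - 1) * cexp (-(r * t)) = r ^ (-a) * Gamma a := by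
  have hU : IsOpen {z : ℂ | 0 < z.re} := isOpen_lt continuous_const continuous_re
  have h1 : AnalyticOnNhd ℂ
      (fun r : ℂ ↦ ∫ t in Ioi (0 : ℝ), (t : ℂ) ^ (a - 1) * cexp (-(r * t))) {z : ℂ | 0 < z.re} :=
    DifferentiableOn.analyticOnNhd (fun z hz ↦
      (differentiableAt_integral_cpow_mul_exp_neg ha hz).differentiableWithinAt) hU
  have h2 : AnalyticOnNhd ℂ (fun r : ℂ ↦ r ^ (-a) * Gamma a) {z : ℂ | 0 < z.re} :=
    DifferentiableOn.analyticOnNhd (fun z hz ↦ DifferentiableAt.differentiableWithinAt <|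
      ((hasDerivAt_id z).cpow_const (Or.inl hz)).differentiableAt.mul_const _) hU
  -- Both sides are analytic in `r`, and the formula is known for real `r > 0`; these accumulate at
  -- `1`.
  refine h1.eqOn_of_preconnected_of_frequently_eq h2 (convex_halfSpace_re_gt 0).isPreconnected
    (z₀ := 1) (by simp) ?_ hr
  obtain ⟨v, -, hv1, hv⟩ := exists_seq_strictAnti_tendsto (1 : ℝ)
  have hvz : Tendsto (fun n ↦ (v n : ℂ)) atTop (𝓝[≠] 1) := by
    refine tendsto_nhdsWithin_iff.2 ⟨?_, .of_forall fun n ↦ ?_⟩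
    · exact (by simpa using continuous_ofReal.tendsto 1 : Tendsto ofReal (𝓝 1) (𝓝 1)).comp hv
    · simpa using (hv1 n).ne'
  refine hvz.frequently (.of_forall fun n ↦ ?_)
  have hpos : 0 < v n := one_pos.trans (hv1 n)
  rw [Complex.integral_cpow_mul_exp_neg_mul_Ioi ha hpos, one_div, inv_cpow, cpow_neg]
  rw [arg_ofReal_of_nonneg hpos.le]
  exact Real.pi_pos.ne

/-! ### Bounds on the integrand, absolute convergence, and entirety of `φ` -/

theorem norm_one_sub_exp_le (z : ℂ) : ‖1 - cexp z‖ ≤ ‖z‖ * Real.exp ‖z‖ := by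
  simpa [norm_sub_rev] using norm_exp_sub_sum_le_norm_mul_exp z 1

theorem norm_one_sub_cos_le (z : ℂ) : ‖1 - Complex.cos z‖ ≤ ‖z‖ ^ 2 * Real.exp ‖z‖ := by
  have h (w : ℂ) : ‖cexp w - (1 + w)‖ ≤ ‖w‖ ^ 2 * Real.exp ‖w‖ := by
    simpa [Finset.sum_range_succ] using norm_exp_sub_sum_le_norm_mul_exp w 2
  have h1 := h (z * I)
  have h2 := h (-z * I)
  have h3 : 1 - Complex.cos z =
      -((cexp (z * I) - (1 + z * I)) + (cexp (-z * I) - (1 + -z * I))) / 2 := by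
    rw [Complex.cos]; ring
  simp only [norm_mul, norm_neg, norm_I, mul_one] at h1 h2
  rw [h3, norm_div, norm_neg, RCLike.norm_ofNat, div_le_iff₀ two_pos]
  linarith [norm_add_le (cexp (z * I) - (1 + z * I)) (cexp (-z * I) - (1 + -z * I))]

theorem Real.arctan_le_self {x : ℝ} (hx : 0 ≤ x) : Real.arctan x ≤ x := by
  simpa using Real.le_tan (Real.arctan_nonneg.2 hx) (Real.arctan_lt_pi_div_two x)

theorem one_add_sq_cpow_eq_exp (k : ℂ) (u : ℝ) :
    ((1 + u ^ 2 : ℝ) : ℂ) ^ (k / 2) = cexp (k * (Real.log (1 + u ^ 2) / 2 : ℝ)) := by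
  have h : (0 : ℝ) < 1 + u ^ 2 := by positivity
  rw [cpow_def_of_ne_zero (ofReal_ne_zero.2 h.ne'), ← ofReal_log h.le]
  push_cast
  ring_nf

/-- Split `1 - xy = (1 - x) + x(1 - y)`; both parts are `O(u²)`, which cancels the double pole of
`csch²` at `0`. The bound is uniform on `‖k‖ ≤ N`, as needed for holomorphy. -/
theorem norm_one_sub_cpow_mul_cos_le {k : ℂ} {N : ℕ} (hk : ‖k‖ ≤ N) {u : ℝ} (hu : 0 ≤ u) :
    ‖1 - ((1 + u ^ 2 : ℝ) : ℂ) ^ (k / 2) * Complex.cos (k * (Real.arctan u : ℂ))‖ ≤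
      (N + N ^ 2 * Real.exp (2 * N)) * (u ^ 2 * (1 + u ^ 2) ^ N) := by
  have hpos : (0 : ℝ) < 1 + u ^ 2 := by positivity
  set a : ℝ := Real.log (1 + u ^ 2) / 2 with ha
  set b : ℝ := Real.arctan u
  rw [one_add_sq_cpow_eq_exp, ← ha]
  have hN : (0 : ℝ) ≤ N := N.cast_nonneg
  have hlog : 0 ≤ Real.log (1 + u ^ 2) := Real.log_nonneg (by nlinarith)
  have ha0 : 0 ≤ a := by positivity
  have ha1 : a ≤ u ^ 2 := by
    have := Real.log_le_sub_one_of_pos hpos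
    have := sq_nonneg u
    linarith
  have hexp : Real.exp (N * a) ≤ (1 + u ^ 2) ^ N := by
    rw [← Real.exp_log (pow_pos hpos N), Real.log_pow]
    gcongr
    linarith
  have hb0 : 0 ≤ b := Real.arctan_nonneg.2 hu
  have hb1 : b ≤ u := Real.arctan_le_self hu
  have hb2 : b ≤ 2 := by linarith [Real.arctan_lt_pi_div_two u, Real.pi_lt_four]
  have hka : ‖k * (a : ℂ)‖ ≤ N * a := by
    rw [norm_mul, norm_real, Real.norm_of_nonneg ha0]; gcongr
  have hkb : ‖k * (b : ℂ)‖ ≤ N * b := by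
    rw [norm_mul, norm_real, Real.norm_of_nonneg hb0]; gcongr
  have h1 : ‖1 - cexp (k * a)‖ ≤ N * u ^ 2 * (1 + u ^ 2) ^ N :=
    calc _ ≤ ‖k * (a : ℂ)‖ * Real.exp ‖k * (a : ℂ)‖ := norm_one_sub_exp_le _
      _ ≤ N * a * Real.exp (N * a) := by gcongr
      _ ≤ _ := by gcongr
  have h2 : ‖1 - Complex.cos (k * b)‖ ≤ (N * u) ^ 2 * Real.exp (2 * N) :=
    calc _ ≤ ‖k * (b : ℂ)‖ ^ 2 * Real.exp ‖k * (b : ℂ)‖ := norm_one_sub_cos_le _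
      _ ≤ (N * b) ^ 2 * Real.exp (N * b) := by gcongr
      _ ≤ (N * u) ^ 2 * Real.exp (2 * N) := by
        rw [mul_comm (2 : ℝ)]; gcongr
  have h3 : ‖cexp (k * a)‖ ≤ (1 + u ^ 2) ^ N :=
    calc _ ≤ Real.exp ‖k * (a : ℂ)‖ := norm_exp_le_exp_norm _
      _ ≤ Real.exp (N * a) := by gcongr
      _ ≤ _ := hexp
  calc ‖1 - cexp (k * a) * Complex.cos (k * b)‖
      = ‖(1 - cexp (k * a)) + cexp (k * a) * (1 - Complex.cos (k * b))‖ := by ring_nf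
    _ ≤ ‖1 - cexp (k * a)‖ + ‖cexp (k * a)‖ * ‖1 - Complex.cos (k * b)‖ := by
        rw [← norm_mul]; exact norm_add_le _ _
    _ ≤ N * u ^ 2 * (1 + u ^ 2) ^ N + (1 + u ^ 2) ^ N * ((N * u) ^ 2 * Real.exp (2 * N)) := by
        gcongr
    _ = _ := by ring

/-- One bound for the pole at `0` and the decay at infinity; it amounts to `1 + 2x ≤ e^(2x)`. -/
theorem inv_sinh_le {x : ℝ} (hx : 0 < x) :
    (Real.sinh x)⁻¹ ≤ Real.exp (-x) * (1 + 2 * x) / x := by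
  have hs : 0 < Real.sinh x := Real.sinh_pos_iff.2 hx
  rw [inv_le_comm₀ hs (by positivity), inv_div, div_le_iff₀ (by positivity), Real.sinh_eq]
  have h1 : 2 * x + 1 ≤ Real.exp (2 * x) := Real.add_one_le_exp _
  have h2 : Real.exp x * Real.exp (-x) = 1 := by rw [← Real.exp_add]; simp
  have h3 : Real.exp (2 * x) * (Real.exp (-x) * Real.exp (-x)) = 1 := by
    rw [← Real.exp_add, ← Real.exp_add]; ring_nf; simp
  have h4 : (1 + 2 * x) * (Real.exp (-x) * Real.exp (-x)) ≤ 1 := by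
    rw [← h3]; gcongr; linarith
  nlinarith

/-- Products of `csch² (π u / 2)`, `u²` and a power of `1 + u²` decay exponentially. -/
theorem exists_inv_sinh_sq_mul_le (N : ℕ) : ∃ C : ℝ, 0 ≤ C ∧ ∀ u : ℝ, 0 < u →
    (Real.sinh (Real.pi * u / 2))⁻¹ ^ 2 * (u ^ 2 * (1 + u ^ 2) ^ N) ≤ C * Real.exp (-u) := by
  -- The `16` is the square of the `4` in `1 + πu ≤ 4(1 + u)`; the rest comes from `(1 + u)^m ≤ m!
  -- e^(1+u)` with `m = 2N + 2`.
  refine ⟨16 * (2 * N + 2).factorial * Real.exp 1, by positivity, fun u hu ↦ ?_⟩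
  have hpi := Real.pi_pos
  have hpi3 := Real.pi_gt_three
  have hpi4 := Real.pi_lt_four
  set x := Real.pi * u / 2 with hx
  have hx0 : 0 < x := by positivity
  have hux : u ≤ x := by rw [hx]; nlinarith
  have hs : 0 < Real.sinh x := Real.sinh_pos_iff.2 hx0
  have h1 : (Real.sinh x)⁻¹ * u ≤ Real.exp (-x) * (4 * (1 + u)) := by
    calc (Real.sinh x)⁻¹ * u ≤ Real.exp (-x) * (1 + 2 * x) / x * u := by
          gcongr; exact inv_sinh_le hx0
      _ ≤ Real.exp (-x) * (1 + 2 * x) / x * x := by gcongr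
      _ = Real.exp (-x) * (1 + 2 * x) := by field_simp
      _ ≤ _ := by
        gcongr
        rw [hx]; nlinarith
  have h2 : (1 + u) ^ (2 * N + 2) ≤ (2 * N + 2).factorial * Real.exp (1 + u) := by
    have := Real.pow_div_factorial_le_exp (x := 1 + u) (by positivity) (2 * N + 2)
    rwa [div_le_iff₀ (by positivity), mul_comm (Real.exp _)] at this
  calc (Real.sinh x)⁻¹ ^ 2 * (u ^ 2 * (1 + u ^ 2) ^ N)
      = ((Real.sinh x)⁻¹ * u) ^ 2 * (1 + u ^ 2) ^ N := by ring
    _ ≤ (Real.exp (-x) * (4 * (1 + u))) ^ 2 * ((1 + u) ^ 2) ^ N := by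
        gcongr; nlinarith
    _ = 16 * (1 + u) ^ (2 * N + 2) * (Real.exp (-x) ^ 2) := by
        rw [← pow_mul, pow_add]; ring
    _ ≤ 16 * ((2 * N + 2).factorial * Real.exp (1 + u)) * Real.exp (-2 * u) := by
        gcongr
        rw [← Real.exp_nat_mul, Real.exp_le_exp]
        push_cast; linarith
    _ = _ := by
        have h3 : Real.exp (1 + u) * Real.exp (-2 * u) = Real.exp 1 * Real.exp (-u) := by
          rw [← Real.exp_add, ← Real.exp_add]; ring_nf
        linear_combination 16 * ((2 * N + 2).factorial : ℝ) * h3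

theorem exists_norm_varphiIntegrand_le (N : ℕ) : ∃ C : ℝ, ∀ k : ℂ, ‖k‖ ≤ N → ∀ u : ℝ, 0 < u →
    ‖varphiIntegrand k u‖ ≤ C * Real.exp (-u) := by
  obtain ⟨C, -, h⟩ := exists_inv_sinh_sq_mul_le N
  refine ⟨(N + N ^ 2 * Real.exp (2 * N)) * C, fun k hk u hu ↦ ?_⟩
  rw [varphiIntegrand, norm_mul, norm_real, Real.norm_of_nonneg (by positivity)]
  calc _ ≤ (Real.sinh (Real.pi * u / 2))⁻¹ ^ 2 *
        ((N + N ^ 2 * Real.exp (2 * N)) * (u ^ 2 * (1 + u ^ 2) ^ N)) := by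
        gcongr
        exact norm_one_sub_cpow_mul_cos_le hk hu.le
    _ = (N + N ^ 2 * Real.exp (2 * N)) *
        ((Real.sinh (Real.pi * u / 2))⁻¹ ^ 2 * (u ^ 2 * (1 + u ^ 2) ^ N)) := by ring
    _ ≤ (N + N ^ 2 * Real.exp (2 * N)) * (C * Real.exp (-u)) :=
        mul_le_mul_of_nonneg_left (h u hu) (by positivity)
    _ = _ := by ring

theorem measurable_varphiIntegrand (k : ℂ) : Measurable (varphiIntegrand k) := by
  unfold varphiIntegrand
  refine Measurable.mul (by fun_prop) (Measurable.const_sub (Measurable.mul ?_ ?_) _)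
  · fun_prop
  · have := Real.continuous_arctan.measurable
    fun_prop

theorem integrableOn_varphiIntegrand (k : ℂ) : IntegrableOn (varphiIntegrand k) (Ioi 0) := by
  obtain ⟨N, hN⟩ := exists_nat_ge ‖k‖
  obtain ⟨C, hC⟩ := exists_norm_varphiIntegrand_le N
  refine ((integrableOn_exp_neg_Ioi 0).const_mul C).mono'
    (measurable_varphiIntegrand k).aestronglyMeasurable ?_
  filter_upwards [ae_restrict_mem measurableSet_Ioi] with u hu using hC k hN u hu

theorem differentiable_varphiIntegrand (u : ℝ) : Differentiable ℂ (varphiIntegrand · u) := by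
  unfold varphiIntegrand
  simp only [one_add_sq_cpow_eq_exp]
  fun_prop

theorem differentiable_varphi : Differentiable ℂ varphi := by
  intro k
  obtain ⟨N, hN⟩ := exists_nat_ge (‖k‖ + 1)
  obtain ⟨C, hC⟩ := exists_norm_varphiIntegrand_le N
  have := differentiableAt_integral_of_dominated_ball (F := varphiIntegrand) (z₀ := k) one_pos
    (fun z _ ↦ (measurable_varphiIntegrand z).aestronglyMeasurable)
    (.of_forall fun u ↦ (differentiable_varphiIntegrand u).differentiableOn)
    (bound := fun u ↦ C * Real.exp (-u)) ?_ ((integrableOn_exp_neg_Ioi 0).const_mul C)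
  · unfold varphi
    fun_prop
  · filter_upwards [ae_restrict_mem measurableSet_Ioi] with u hu z hz
    refine hC z ?_ u hu
    have := norm_add_le (z - k) k
    have := mem_ball_iff_norm.1 hz
    simp only [sub_add_cancel] at *
    linarith

/-! ### The integrand as a Laplace-type integral -/

theorem log_one_add_mul_I (u : ℝ) :
    Complex.log (1 + u * I) = (Real.log (1 + u ^ 2) / 2 : ℝ) + (Real.arctan u : ℝ) * I := by
  have hnorm : ‖(1 + u * I : ℂ)‖ = √(1 + u ^ 2) := by
    simpa using norm_add_mul_I 1 u
  have harg : (1 + u * I : ℂ).arg = Real.arctan u := by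
    rw [arg_of_re_nonneg (by simp), hnorm, Real.arctan_eq_arcsin]; simp
  rw [Complex.log, hnorm, harg, Real.log_sqrt (by positivity)]

/-- By the polar form of `1 ± iu`, the product in the integrand is the mean of `(1 + iu)^k` and `(1
- iu)^k`, which is what Laplace transforms of `t^(a-1)` at `1 ± iu` produce. -/
theorem one_add_mul_I_cpow_add (k : ℂ) (u : ℝ) :
    (1 + u * I) ^ k + (1 + ((-u : ℝ) : ℂ) * I) ^ k =
      2 * (((1 + u ^ 2 : ℝ) : ℂ) ^ (k / 2) * Complex.cos (k * (Real.arctan u : ℂ))) := by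
  have h (v : ℝ) : (1 + v * I : ℂ) ≠ 0 := fun h ↦ by simpa using congrArg re h
  rw [one_add_sq_cpow_eq_exp, cpow_def_of_ne_zero (h _), cpow_def_of_ne_zero (h _),
    log_one_add_mul_I, log_one_add_mul_I, Complex.cos, Real.arctan_neg]
  push_cast
  rw [neg_sq, mul_div_assoc', mul_div_assoc', mul_div_cancel_left_of_imp (by simp), mul_add,
    ← exp_add, ← exp_add]
  ring_nf

/-- `Γ(a) (1 - (1 + u²) ^ (-a / 2) cos (a arctan u))` as a Laplace-type integral. -/
theorem integral_cpow_mul_exp_neg_mul_one_sub_cos {a : ℂ} (ha : 0 < a.re) (u : ℝ) :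
    ∫ t in Ioi (0 : ℝ), (t : ℂ) ^ (a - 1) * Real.exp (-t) * (1 - Real.cos (u * t) : ℝ) =
      Gamma a *
        (1 - ((1 + u ^ 2 : ℝ) : ℂ) ^ (-a / 2) * Complex.cos (-a * (Real.arctan u : ℂ))) := by
  have hre (v : ℝ) : 0 < (1 + v * I : ℂ).re := by simp
  have h1 := integrableOn_cpow_mul_exp_neg ha (r := 1) (by simp)
  have h2 := integrableOn_cpow_mul_exp_neg ha (hre u)
  have h3 := integrableOn_cpow_mul_exp_neg ha (hre (-u))
  have e1 := integral_cpow_mul_exp_neg_mul ha (r := 1) (by simp)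
  have e2 := integral_cpow_mul_exp_neg_mul ha (hre u)
  have e3 := integral_cpow_mul_exp_neg_mul ha (hre (-u))
  have key : ∀ t : ℝ, (t : ℂ) ^ (a - 1) * Real.exp (-t) * (1 - Real.cos (u * t) : ℝ) =
      (t : ℂ) ^ (a - 1) * cexp (-(1 * t)) -
        ((t : ℂ) ^ (a - 1) * cexp (-((1 + u * I) * t)) +
          (t : ℂ) ^ (a - 1) * cexp (-((1 + ((-u : ℝ) : ℂ) * I) * t))) / 2 := by
    intro t
    have e4 : cexp (-((1 + u * I) * t)) = cexp (-t) * cexp (-(u * t) * I) := by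
      rw [← exp_add]; ring_nf
    have e5 : cexp (-((1 + ((-u : ℝ) : ℂ) * I) * t)) = cexp (-t) * cexp ((u * t) * I) := by
      rw [← exp_add]; push_cast; ring_nf
    rw [e4, e5]
    push_cast
    rw [Complex.cos, one_mul]
    ring
  simp only [key]
  rw [integral_sub h1 (Integrable.div_const (Integrable.fun_add h2 h3) 2), integral_div, integral_add h2 h3, e1, e2, e3, ← add_mul,
    one_add_mul_I_cpow_add, one_cpow]
  ring

/-! ### The cosine transform of `csch²` -/

/-- With `q = e^(-2x)`, `csch² x = 4q / (1 - q)² = 4 ∑ n qⁿ`; the vanishing term `n = 0` is dropped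
by a shift. -/
theorem hasSum_inv_sinh_sq {x : ℝ} (hx : 0 < x) :
    HasSum (fun n : ℕ ↦ 4 * ((n + 1) * Real.exp (-((n + 1) * (2 * x)))))
      ((Real.sinh x)⁻¹ ^ 2) := by
  have hlt : Real.exp (-(2 * x)) < 1 := Real.exp_lt_one_iff.2 (by linarith)
  have h := (hasSum_coe_mul_geometric_of_norm_lt_one (𝕜 := ℝ) (r := Real.exp (-(2 * x)))
    (by rwa [Real.norm_of_nonneg (by positivity)])).mul_left 4
  rw [← hasSum_nat_add_iff' 1] at h
  have h3 : Real.exp x * Real.exp (-x) = 1 := by rw [← Real.exp_add]; simp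
  have h2 : Real.exp (-(2 * x)) = Real.exp (-x) ^ 2 := by
    rw [← Real.exp_nat_mul]; push_cast; ring_nf
  have h4 : 0 < 1 - Real.exp (-x) ^ 2 := by rw [← h2]; linarith
  have h5 : Real.sinh x * (2 * Real.exp (-x)) = 1 - Real.exp (-x) ^ 2 := by
    rw [Real.sinh_eq]; linear_combination h3
  have hs : 0 < Real.sinh x := Real.sinh_pos_iff.2 hx
  convert! h using 1
  · ext n
    rw [← Real.exp_nat_mul, mul_neg]
    push_cast
    rfl
  · simp only [Finset.range_one, Finset.sum_singleton, Nat.cast_zero, zero_mul, mul_zero, sub_zero]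
    rw [h2, ← h5]
    have := Real.exp_pos (-x)
    field_simp
    norm_num

theorem integrableOn_exp_neg_mul_one_sub_cos {b : ℝ} (hb : 0 < b) (t : ℝ) :
    IntegrableOn (fun u ↦ Real.exp (-(b * u)) * (1 - Real.cos (u * t))) (Ioi 0) := by
  refine ((exp_neg_integrableOn_Ioi 0 hb).const_mul 2).mono'
    (by fun_prop) (.of_forall fun u ↦ ?_)
  have := Real.cos_le_one (u * t)
  have := Real.neg_one_le_cos (u * t)
  rw [Real.norm_of_nonneg (mul_nonneg (Real.exp_pos _).le (by linarith)), mul_comm, neg_mul]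
  gcongr
  linarith

theorem integral_exp_neg_mul_one_sub_cos {b : ℝ} (hb : 0 < b) (t : ℝ) :
    ∫ u in Ioi (0 : ℝ), Real.exp (-(b * u)) * (1 - Real.cos (u * t)) =
      t ^ 2 / (b * (b ^ 2 + t ^ 2)) := by
  have hre (s : ℝ) : (-b + s * I : ℂ).re < 0 := by simpa
  have hne (s : ℝ) : (-b + s * I : ℂ) ≠ 0 := fun h ↦ (hre s).ne (by rw [h]; simp)
  have hi (s : ℝ) := integrableOn_exp_mul_complex_Ioi (hre s) 0
  have e (s : ℝ) := integral_exp_mul_complex_Ioi (hre s) 0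
  apply ofReal_injective
  rw [← integral_complex_ofReal]
  have key : ∀ u : ℝ, ((Real.exp (-(b * u)) * (1 - Real.cos (u * t)) : ℝ) : ℂ) =
      cexp ((-b + (0 : ℝ) * I) * u) -
        (cexp ((-b + t * I) * u) + cexp ((-b + ((-t : ℝ) : ℂ) * I) * u)) / 2 := by
    intro u
    push_cast
    rw [Complex.cos, zero_mul, add_zero]
    simp only [add_mul, exp_add]
    ring_nf
  simp only [key]
  rw [integral_sub (hi 0) (Integrable.div_const (Integrable.fun_add (hi t) (hi (-t))) 2), integral_div,
    integral_add (hi t) (hi (-t)), e, e, e]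
  have h0 : (b : ℂ) ≠ 0 := ofReal_ne_zero.2 hb.ne'
  have h1 := hne t
  have h2 := hne (-t)
  have h4 : (b : ℂ) ^ 2 + t ^ 2 = (-b + t * I) * (-b + ((-t : ℝ) : ℂ) * I) := by
    push_cast; linear_combination (t : ℂ) ^ 2 * I_sq
  have h5 : (-b + t * I) + (-b + ((-t : ℝ) : ℂ) * I) = -(2 * b) := by push_cast; ring
  simp only [ofReal_zero, mul_zero, zero_mul, add_zero, exp_zero]
  push_cast [-ofReal_neg]
  have h6 : (t : ℂ) ^ 2 = (-b + t * I) * (-b + ((-t : ℝ) : ℂ) * I) - b ^ 2 := by rw [← h4]; ring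
  rw [h4, h6]
  generalize (-b + t * I : ℂ) = p at *
  generalize (-b + ((-t : ℝ) : ℂ) * I) = q at *
  field_simp
  linear_combination (b : ℂ) * h5

/-- The Mittag-Leffler expansion of `t coth t - 1`. -/
theorem hasSum_mul_coth_sub_one {t : ℝ} (ht : 0 < t) :
    HasSum (fun n : ℕ ↦ 2 * t ^ 2 / (((n + 1) * Real.pi) ^ 2 + t ^ 2))
      (t * (Real.cosh t / Real.sinh t) - 1) := by
  have hpi := Real.pi_pos
  have hpi' : (Real.pi : ℂ) ≠ 0 := ofReal_ne_zero.2 hpi.ne'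
  have htc : (t : ℂ) ≠ 0 := ofReal_ne_zero.2 ht.ne'
  -- At `z = it/π` the cotangent expansion becomes hyperbolic, as `πz = it`.
  set z : ℂ := ((t / Real.pi : ℝ) : ℂ) * I with hz
  have hzmem : z ∈ integerComplement := by
    rintro ⟨m, hm⟩
    have := congrArg im hm
    rw [hz, im_ofReal_mul] at this
    simp only [intCast_im, I_im, mul_one] at this
    exact (div_pos ht hpi).ne this
  have hpz : Real.pi * z = t * I := by
    rw [hz]; push_cast; field_simp
  have hcot : Real.pi * cot (Real.pi * z) - 1 / z =
      -(Real.pi * I / t) * ((t * (Real.cosh t / Real.sinh t) - 1 : ℝ) : ℂ) := by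
    have hs : Complex.sinh t ≠ 0 := by
      rw [← ofReal_sinh]; exact ofReal_ne_zero.2 (Real.sinh_pos_iff.2 ht).ne'
    rw [hpz, Complex.cot, Complex.cos_mul_I, Complex.sin_mul_I, hz]
    push_cast
    field_simp
    linear_combination ((t : ℂ) * Complex.cosh t - Complex.sinh t) * I_sq
  have h1 := (summable_cotTerm hzmem).hasSum
  rw [← cot_series_rep' hzmem, hcot] at h1
  rw [← Complex.hasSum_ofReal,
    ← hasSum_mul_left_iff (neg_ne_zero.2 (div_ne_zero (mul_ne_zero hpi' I_ne_zero) htc))]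
  convert! h1 using 2 with n
  have h2 : ((((n + 1) * Real.pi) ^ 2 + t ^ 2 : ℝ) : ℂ) ≠ 0 := ofReal_ne_zero.2 (by positivity)
  have h3 : (z + (n + 1)) * (z - (n + 1)) =
      -((((n + 1) * Real.pi) ^ 2 + t ^ 2 : ℝ) : ℂ) / Real.pi ^ 2 := by
    rw [hz]
    push_cast
    field_simp
    linear_combination (t : ℂ) ^ 2 * I_sq
  rw [cotTerm_identity hzmem, h3, hz]
  push_cast at *
  field_simp

/-- Expand `csch²` in exponentials: the terms integrate to the partial fractions of `t coth t - 1`.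
They are nonnegative, so summability of their integrals justifies the interchange. -/
theorem integral_inv_sinh_sq_mul_one_sub_cos {t : ℝ} (ht : 0 < t) :
    ∫ u in Ioi (0 : ℝ), (Real.sinh (Real.pi * u / 2))⁻¹ ^ 2 * (1 - Real.cos (u * t)) =
      2 / Real.pi * (t * (Real.cosh t / Real.sinh t) - 1) := by
  have hpi := Real.pi_pos
  set F : ℕ → ℝ → ℝ := fun n u ↦ 4 * (n + 1) *
    (Real.exp (-((n + 1) * Real.pi * u)) * (1 - Real.cos (u * t))) with hF
  have hb (n : ℕ) : 0 < ((n : ℝ) + 1) * Real.pi := by positivity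
  have hF_int (n : ℕ) : IntegrableOn (F n) (Ioi 0) :=
    (integrableOn_exp_neg_mul_one_sub_cos (hb n) t).const_mul _
  have hF_nonneg (n : ℕ) (u : ℝ) : 0 ≤ F n u := by
    have := Real.cos_le_one (u * t)
    have : 0 ≤ 1 - Real.cos (u * t) := by linarith
    positivity
  have hF_eq (n : ℕ) : ∫ u in Ioi (0 : ℝ), F n u =
      2 / Real.pi * (2 * t ^ 2 / (((n + 1) * Real.pi) ^ 2 + t ^ 2)) := by
    rw [hF, integral_const_mul, integral_exp_neg_mul_one_sub_cos (hb n)]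
    have : (n : ℝ) + 1 ≠ 0 := by positivity
    have : ((n : ℝ) + 1) ^ 2 * Real.pi ^ 2 + t ^ 2 ≠ 0 := by positivity
    rw [mul_pow]
    field_simp
    norm_num
  have hsum := (hasSum_mul_coth_sub_one ht).mul_left (2 / Real.pi)
  have h := hasSum_integral_of_summable_integral_norm hF_int (by
    simp only [Real.norm_of_nonneg (hF_nonneg _ _), hF_eq]
    exact hsum.summable)
  simp only [hF_eq] at h
  rw [← h.unique hsum]
  refine setIntegral_congr_fun measurableSet_Ioi fun u (hu : 0 < u) ↦ ?_
  have hx : 0 < Real.pi * u / 2 := by positivity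
  rw [← ((hasSum_inv_sinh_sq hx).mul_right (1 - Real.cos (u * t))).tsum_eq]
  refine tsum_congr fun n ↦ ?_
  simp only [hF]
  rw [show (n + 1) * Real.pi * u = (n + 1) * (2 * (Real.pi * u / 2)) by ring]
  ring

/-! ### Interchanging the two integrals -/

theorem integrableOn_inv_sinh_sq_mul_sq :
    IntegrableOn (fun u : ℝ ↦ (Real.sinh (Real.pi * u / 2))⁻¹ ^ 2 * u ^ 2) (Ioi 0) := by
  obtain ⟨C, -, hC⟩ := exists_inv_sinh_sq_mul_le 0
  refine ((integrableOn_exp_neg_Ioi 0).const_mul C).mono'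
    (by fun_prop) ?_
  filter_upwards [ae_restrict_mem measurableSet_Ioi] with u hu
  rw [Real.norm_of_nonneg (by positivity)]
  simpa using hC u hu

/-- The bound `1 - cos(ut) ≤ (ut)²` separates the variables and cancels the pole of `csch²`. -/
theorem integrable_prod_cpow_mul_inv_sinh_sq {a : ℂ} (ha : 0 < a.re) :
    Integrable (Function.uncurry fun u t : ℝ ↦
      (((Real.sinh (Real.pi * u / 2))⁻¹ ^ 2 : ℝ) : ℂ) *
        ((t : ℂ) ^ (a - 1) * Real.exp (-t) * (1 - Real.cos (u * t) : ℝ)))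
      ((volume.restrict (Ioi 0)).prod (volume.restrict (Ioi 0))) := by
  have h1 := integrableOn_rpow_mul_exp_neg_mul (p := a.re + 2) (b := 1) (by linarith) one_pos
  refine (integrableOn_inv_sinh_sq_mul_sq.mul_prod h1).mono' ?_ ?_
  · refine Measurable.aestronglyMeasurable ?_
    unfold Function.uncurry
    fun_prop
  · rw [Measure.prod_restrict]
    filter_upwards [ae_restrict_mem (measurableSet_Ioi.prod measurableSet_Ioi)] with ⟨u, t⟩ ⟨hu, ht⟩
    have hu' : 0 < u := hu
    have ht' : 0 < t := ht
    have hcos := Real.cos_le_one (u * t)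
    have hcos' := Real.one_sub_sq_div_two_le_cos (x := u * t)
    simp only [Function.uncurry_apply_pair, norm_mul, norm_real, norm_cpow_eq_rpow_re_of_pos ht']
    rw [Real.norm_of_nonneg (by positivity), Real.norm_of_nonneg (by positivity),
      Real.norm_of_nonneg (by linarith)]
    have h2 : t ^ (a.re + 2 - 1) = t ^ (a.re - 1) * t ^ 2 := by
      rw [← Real.rpow_natCast, ← Real.rpow_add ht']; push_cast; ring_nf
    rw [h2, one_mul, sub_re, one_re]
    calc _ ≤ (Real.sinh (Real.pi * u / 2))⁻¹ ^ 2 *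
          (t ^ (a.re - 1) * Real.exp (-t) * (u * t) ^ 2) := by
          gcongr
          nlinarith [sq_nonneg (u * t)]
      _ = _ := by ring

theorem Gamma_mul_integral_varphiIntegrand {a : ℂ} (ha : 0 < a.re) :
    IntegrableOn (fun t : ℝ ↦ (t : ℂ) ^ (a - 1) * Real.exp (-t) *
      (t * (Real.cosh t / Real.sinh t) - 1 : ℝ)) (Ioi 0) ∧
    Gamma a * ((Real.pi / 2) * ∫ u in Ioi (0 : ℝ), varphiIntegrand (-a) u) =
      ∫ t in Ioi (0 : ℝ), (t : ℂ) ^ (a - 1) * Real.exp (-t) *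
        (t * (Real.cosh t / Real.sinh t) - 1 : ℝ) := by
  have hpi : (Real.pi : ℂ) ≠ 0 := ofReal_ne_zero.2 Real.pi_pos.ne'
  have hint := integrable_prod_cpow_mul_inv_sinh_sq ha
  have inner : ∀ t ∈ Ioi (0 : ℝ), ∫ u in Ioi (0 : ℝ),
      (((Real.sinh (Real.pi * u / 2))⁻¹ ^ 2 : ℝ) : ℂ) *
        ((t : ℂ) ^ (a - 1) * Real.exp (-t) * (1 - Real.cos (u * t) : ℝ)) =
      2 / Real.pi * ((t : ℂ) ^ (a - 1) * Real.exp (-t) *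
        (t * (Real.cosh t / Real.sinh t) - 1 : ℝ)) := by
    intro t ht
    have h := congrArg (fun x : ℝ ↦ (t : ℂ) ^ (a - 1) * Real.exp (-t) * (x : ℂ))
      (integral_inv_sinh_sq_mul_one_sub_cos ht)
    simp only [← integral_complex_ofReal, ← integral_const_mul] at h
    rw [ofReal_mul, mul_left_comm, ofReal_div, ofReal_ofNat] at h
    rw [← h]
    refine integral_congr_ae (.of_forall fun u ↦ ?_)
    simp only [ofReal_mul]
    ring
  constructor
  · refine (integrable_congr ?_).1 (hint.integral_prod_right.const_mul (Real.pi / 2 : ℂ))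
    filter_upwards [ae_restrict_mem measurableSet_Ioi] with t ht
    simp only [Function.uncurry_apply_pair]
    rw [inner t ht]
    field_simp
  · have hswap := integral_integral_swap hint
    rw [setIntegral_congr_fun measurableSet_Ioi inner, integral_const_mul] at hswap
    simp only [integral_const_mul, integral_cpow_mul_exp_neg_mul_one_sub_cos ha] at hswap
    have h1 : ∫ u in Ioi (0 : ℝ), (((Real.sinh (Real.pi * u / 2))⁻¹ ^ 2 : ℝ) : ℂ) *
        (Gamma a * (1 - ((1 + u ^ 2 : ℝ) : ℂ) ^ (-a / 2) *
          Complex.cos (-a * (Real.arctan u : ℂ)))) =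
        Gamma a * ∫ u in Ioi (0 : ℝ), varphiIntegrand (-a) u := by
      rw [← integral_const_mul]
      refine integral_congr_ae (.of_forall fun u ↦ ?_)
      simp only [varphiIntegrand]
      ring
    rw [h1] at hswap
    rw [mul_left_comm, hswap]
    field_simp

/-! ### The Mellin transform of `1 / sinh` -/

/-- The Dirichlet series over the odd integers. -/
theorem hasSum_one_div_odd_cpow {s : ℂ} (hs : 1 < s.re) :
    HasSum (fun n : ℕ ↦ 1 / ((2 * n + 1 : ℕ) : ℂ) ^ s) ((1 - (2 : ℂ) ^ (-s)) * riemannZeta s) := by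
  have hsum : Summable fun n : ℕ ↦ 1 / (n : ℂ) ^ s := summable_one_div_nat_cpow.2 hs
  have htot : HasSum (fun n : ℕ ↦ 1 / (n : ℂ) ^ s) (riemannZeta s) := by
    rw [zeta_eq_tsum_one_div_nat_cpow hs]; exact hsum.hasSum
  have heven : HasSum (fun n : ℕ ↦ 1 / ((2 * n : ℕ) : ℂ) ^ s) ((2 : ℂ) ^ (-s) * riemannZeta s) := by
    convert! htot.mul_left ((2 : ℂ) ^ (-s)) using 2 with n
    rw [Nat.cast_mul, natCast_mul_natCast_cpow, cpow_neg, Nat.cast_ofNat]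
    ring
  have hodd : Summable fun n : ℕ ↦ 1 / ((2 * n + 1 : ℕ) : ℂ) ^ s :=
    hsum.comp_injective (i := fun n ↦ 2 * n + 1) fun m n h ↦ by simpa using h
  have := (heven.even_add_odd (f := fun n : ℕ ↦ 1 / (n : ℂ) ^ s) hodd.hasSum).unique htot
  rw [show (1 - (2 : ℂ) ^ (-s)) * riemannZeta s = ∑' n : ℕ, 1 / ((2 * n + 1 : ℕ) : ℂ) ^ s by
    linear_combination -this]
  exact hodd.hasSum

theorem hasSum_inv_sinh {t : ℝ} (ht : 0 < t) :
    HasSum (fun n : ℕ ↦ (2 : ℂ) * Real.exp (-((2 * n + 1 : ℕ) : ℝ) * t))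
      ((Real.sinh t)⁻¹ : ℝ) := by
  have hlt : Real.exp (-(2 * t)) < 1 := Real.exp_lt_one_iff.2 (by linarith)
  have h := (hasSum_geometric_of_lt_one (Real.exp_pos _).le hlt).mul_left (2 * Real.exp (-t))
  have h3 : Real.exp t * Real.exp (-t) = 1 := by rw [← Real.exp_add]; simp
  have h2 : Real.exp (-(2 * t)) = Real.exp (-t) ^ 2 := by
    rw [← Real.exp_nat_mul]; push_cast; ring_nf
  have h5 : Real.sinh t * (2 * Real.exp (-t)) = 1 - Real.exp (-t) ^ 2 := by
    rw [Real.sinh_eq]; linear_combination h3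
  have hs : 0 < Real.sinh t := Real.sinh_pos_iff.2 ht
  have h6 : (Real.sinh t)⁻¹ = 2 * Real.exp (-t) * (1 - Real.exp (-(2 * t)))⁻¹ := by
    rw [h2, ← h5]
    have := Real.exp_pos (-t)
    field_simp
  rw [← h6, ← Complex.hasSum_ofReal] at h
  convert! h using 2 with n
  rw [← Real.exp_nat_mul, mul_assoc, ← Real.exp_add]
  push_cast
  ring_nf

theorem mellin_inv_sinh {s : ℂ} (hs : 1 < s.re) :
    mellin (fun t : ℝ ↦ (((Real.sinh t)⁻¹ : ℝ) : ℂ)) s =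
      2 * Gamma s * ((1 - (2 : ℂ) ^ (-s)) * riemannZeta s) := by
  refine (hasSum_mellin (a := fun _ : ℕ ↦ (2 : ℂ)) (p := fun n ↦ ((2 * n + 1 : ℕ) : ℝ))
    (fun n ↦ Or.inr (by positivity)) (by linarith) (fun t ht ↦ hasSum_inv_sinh ht) ?_).unique ?_
  · have h := (hasSum_one_div_odd_cpow hs).summable.norm.mul_left 2
    refine h.congr fun n ↦ ?_
    rw [norm_div, norm_natCast_cpow_of_pos (by positivity)]
    simp [div_eq_mul_inv]
  · convert! (hasSum_one_div_odd_cpow hs).mul_left (2 * Gamma s) using 2 with n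
    rw [ofReal_natCast]
    ring

/-! ### The two identities between `φ` and `ζ` -/

/-- Multiplied by `Γ(a)`, the terms `1 + a` give `Γ(a) + Γ(a + 1)`, that is, they add `1 + t` to `t
coth t - 1`; and `e^(-t) t (coth t + 1) = t / sinh t`. -/
theorem varphi_neg_eq {a : ℂ} (ha : 0 < a.re) :
    varphi (-a) = 2 * a * (1 - (2 : ℂ) ^ (-(a + 1))) * riemannZeta (a + 1) := by
  obtain ⟨hint, heq⟩ := Gamma_mul_integral_varphiIntegrand ha
  have ha0 : a ≠ 0 := fun h ↦ by simp [h] at ha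
  have hG : Gamma a ≠ 0 := Gamma_ne_zero_of_re_pos ha
  have ha1 : 0 < (a + 1).re := by simp; linarith
  have i1 := integrableOn_cpow_mul_exp_neg ha (r := 1) (by simp)
  have i2 := integrableOn_cpow_mul_exp_neg ha1 (r := 1) (by simp)
  have e1 := integral_cpow_mul_exp_neg_mul ha (r := 1) (by simp)
  have e2 := integral_cpow_mul_exp_neg_mul ha1 (r := 1) (by simp)
  rw [one_cpow, one_mul] at e1 e2
  have hm := mellin_inv_sinh (s := a + 1) (by simpa using ha)
  have key : mellin (fun t : ℝ ↦ (((Real.sinh t)⁻¹ : ℝ) : ℂ)) (a + 1) =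
      (∫ t in Ioi (0 : ℝ), (t : ℂ) ^ (a - 1) * Real.exp (-t) *
        (t * (Real.cosh t / Real.sinh t) - 1 : ℝ)) + Gamma a + Gamma (a + 1) := by
    rw [← e1, ← e2, ← integral_add hint i1, ← integral_add (Integrable.fun_add hint i1) i2]
    refine setIntegral_congr_fun measurableSet_Ioi fun t (ht : 0 < t) ↦ ?_
    have htc : (t : ℂ) ≠ 0 := ofReal_ne_zero.2 ht.ne'
    have hs : (Real.sinh t : ℂ) ≠ 0 := ofReal_ne_zero.2 (Real.sinh_pos_iff.2 ht).ne'
    have h1 : (t : ℂ) ^ (a + 1 - 1) = t ^ (a - 1) * t := by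
      rw [show a + 1 - 1 = a - 1 + 1 by ring, cpow_add _ _ htc, cpow_one]
    have h2 : cexp (-t) * (Real.cosh t + Real.sinh t) = 1 := by
      rw [ofReal_cosh, ofReal_sinh, Complex.cosh_add_sinh, ← exp_add]; simp
    simp only [smul_eq_mul, h1, one_mul, ofReal_inv, ofReal_sub, ofReal_mul, ofReal_div, ofReal_one,
      ofReal_exp, ofReal_neg]
    field_simp
    linear_combination (-(t : ℂ) ^ (a - 1) * t) * h2
  rw [hm, ← heq, Gamma_add_one a ha0] at key
  rw [varphi]
  refine mul_left_cancel₀ hG ?_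
  linear_combination -key

theorem varphi_one_sub {k : ℂ} (hk : k ≠ 1) :
    2 * (k - 1) * (1 - (2 : ℂ) ^ (-k)) * riemannZeta k = varphi (1 - k) := by
  have hopen : IsOpen ({1}ᶜ : Set ℂ) := isOpen_compl_singleton
  have h1 : AnalyticOnNhd ℂ (fun k ↦ 2 * (k - 1) * (1 - (2 : ℂ) ^ (-k)) * riemannZeta k) {1}ᶜ := by
    refine DifferentiableOn.analyticOnNhd (fun z hz ↦ ?_) hopen
    refine DifferentiableAt.differentiableWithinAt (.mul ?_ (differentiableAt_riemannZeta hz))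
    have : DifferentiableAt ℂ (fun k : ℂ ↦ (2 : ℂ) ^ (-k)) z :=
      (differentiableAt_id.neg).const_cpow (Or.inl two_ne_zero)
    fun_prop
  have h2 : AnalyticOnNhd ℂ (fun k ↦ varphi (1 - k)) {1}ᶜ := by
    refine DifferentiableOn.analyticOnNhd (fun z _ ↦ ?_) hopen
    exact (differentiable_varphi.comp
      (differentiable_id.const_sub 1)).differentiableAt.differentiableWithinAt
  refine h1.eqOn_of_preconnected_of_eventuallyEq h2
    (isConnected_compl_singleton_of_one_lt_rank (by simp) 1).isPreconnected
    (z₀ := 2) (by simp) ?_ hk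
  have hU : {z : ℂ | 1 < z.re} ∈ 𝓝 (2 : ℂ) :=
    (isOpen_lt continuous_const continuous_re).mem_nhds (by simp)
  filter_upwards [hU] with z (hz : 1 < z.re)
  have := varphi_neg_eq (a := z - 1) (by simpa using hz)
  rw [neg_sub, sub_add_cancel] at this
  exact this.symm

theorem varphi_eq {k : ℂ} (hk : k ≠ 0) :
    varphi k = -(2 * k) * (1 - (2 : ℂ) ^ (k - 1)) * riemannZeta (1 - k) := by
  have := varphi_one_sub (k := 1 - k) (fun h ↦ hk (by linear_combination -h))
  rw [sub_sub_cancel, neg_sub] at this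
  rw [← this]; ring

theorem varphi_zero : varphi 0 = 1 := by
  simp [varphi, varphiIntegrand]

theorem varphi_eq_Gamma_mul {k : ℂ} (hk : k ≠ 1) (hk' : ∀ n : ℕ, k ≠ -((n : ℂ) + 1)) :
    -2 * Gamma (k + 1) * ((2 : ℂ) ^ (1 - k) - 1) * (Real.pi : ℂ) ^ (-k) *
      Complex.cos ((Real.pi : ℂ) * k / 2) * riemannZeta k = varphi k := by
  have hpi : (Real.pi : ℂ) ≠ 0 := ofReal_ne_zero.2 Real.pi_pos.ne'
  -- At `k = 0` the reflected argument `1 - k` is the pole of `ζ`, so this value is checked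
  -- directly.
  rcases eq_or_ne k 0 with rfl | hk0
  · rw [varphi_zero, riemannZeta_zero]
    norm_num
  · have hn : ∀ n : ℕ, k ≠ -n := by
      rintro (_ | n)
      · simpa using hk0
      · simpa using hk' n
    have h2 : (2 : ℂ) ^ (1 - k) * 2 ^ (k - 1) = 1 := by
      rw [← cpow_add _ _ two_ne_zero]; simp
    have h3 : (2 : ℂ) ^ (1 - k) = 2 * 2 ^ (-k) := by
      rw [sub_eq_add_neg, cpow_add _ _ two_ne_zero, cpow_one]
    have h4 : (2 * (Real.pi : ℂ)) ^ (-k) = 2 ^ (-k) * (Real.pi : ℂ) ^ (-k) := by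
      simpa using mul_cpow_ofReal_nonneg (a := 2) zero_le_two Real.pi_pos.le (-k)
    rw [varphi_eq hk0, riemannZeta_one_sub hn hk, h4, Gamma_add_one k hk0]
    rw [h3] at h2 ⊢
    linear_combination (-2 * k * Gamma k * (Real.pi : ℂ) ^ (-k) *
      Complex.cos ((Real.pi : ℂ) * k / 2) * riemannZeta k) * h2

/-! ### Zeros of `ζ` and of `φ` -/

theorem one_sub_two_cpow_eq_zero_iff {k : ℂ} :
    1 - (2 : ℂ) ^ (k - 1) = 0 ↔
      ∃ j : ℤ, k = 1 + 2 * (Real.pi : ℂ) * I * (j : ℂ) / ((Real.log 2 : ℝ) : ℂ) := by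
  have hlog : ((Real.log 2 : ℝ) : ℂ) ≠ 0 := ofReal_ne_zero.2 (Real.log_pos one_lt_two).ne'
  rw [sub_eq_zero, eq_comm, cpow_def_of_ne_zero two_ne_zero, exp_eq_one_iff,
    show Complex.log 2 = ((Real.log 2 : ℝ) : ℂ) by simp]
  refine exists_congr fun j ↦ ?_
  rw [← sub_eq_iff_eq_add', eq_div_iff hlog]
  constructor <;> intro h <;> linear_combination h

/-- The zeros of `ζ` in the closed left half-plane are the negative even integers. -/
theorem riemannZeta_eq_zero_iff_of_re_nonpos {k : ℂ} (hk : k.re ≤ 0) :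
    riemannZeta k = 0 ↔ ∃ n : ℕ, k = -2 * ((n : ℂ) + 1) := by
  refine ⟨fun h ↦ ?_, fun ⟨n, hn⟩ ↦ hn ▸ riemannZeta_neg_two_mul_nat_add_one n⟩
  have hpi : (Real.pi : ℂ) ≠ 0 := ofReal_ne_zero.2 Real.pi_pos.ne'
  set s := 1 - k with hs
  have hks : k = 1 - s := by rw [hs]; ring
  have hre : 1 ≤ s.re := by simp [hs, hk]
  have hs1 : s ≠ 1 := by
    rintro h1
    rw [hks, h1, sub_self, riemannZeta_zero] at h
    norm_num at h
  have hsn : ∀ n : ℕ, s ≠ -n := by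
    intro n hn
    rw [hn] at hre
    simp only [neg_re, natCast_re] at hre
    linarith [n.cast_nonneg (α := ℝ)]
  have hG : Gamma s ≠ 0 := Gamma_ne_zero_of_re_pos (by linarith)
  have hz := riemannZeta_ne_zero_of_one_le_re hre
  have hp : (2 * (Real.pi : ℂ)) ^ (-s) ≠ 0 := by
    simp [cpow_eq_zero_iff, hpi]
  rw [hks, riemannZeta_one_sub hsn hs1] at h
  have hcos : Complex.cos (Real.pi * s / 2) = 0 := by
    simpa [hG, hz, hp] using h
  obtain ⟨m, hm⟩ := Complex.cos_eq_zero_iff.1 hcos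
  have hsm : s = 2 * m + 1 := by
    field_simp at hm
    linear_combination hm
  -- `m = 0` would mean `s = 1`, i.e. `k = 0`, where `ζ(0) ≠ 0`.
  have hm0 : 0 < m := by
    have h1 : (0 : ℝ) ≤ m := by
      have := congrArg re hsm
      simp at this
      linarith
    refine lt_of_le_of_ne (by exact_mod_cast h1) ?_
    rintro rfl
    exact hs1 (by simpa using hsm)
  obtain ⟨n, rfl⟩ := Int.eq_succ_of_zero_lt hm0
  refine ⟨n, ?_⟩
  rw [hks, hsm]
  push_cast
  ring

theorem isNontrivialZetaZero_iff {k : ℂ} :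
    IsNontrivialZetaZero k ↔ riemannZeta k = 0 ∧ 0 < k.re ∧ k.re < 1 := by
  constructor
  · rintro ⟨-, h0, hn⟩
    refine ⟨h0, ?_, ?_⟩
    · by_contra! h
      exact hn ((riemannZeta_eq_zero_iff_of_re_nonpos h).1 h0)
    · by_contra! h
      exact riemannZeta_ne_zero_of_one_le_re h h0
  · rintro ⟨h0, h1, h2⟩
    refine ⟨fun h ↦ by simp [h] at h2, h0, ?_⟩
    rintro ⟨n, rfl⟩
    simp at h1
    linarith [n.cast_nonneg (α := ℝ)]

theorem IsTrivialVarphiPoint.one_le_re {k : ℂ} (hk : IsTrivialVarphiPoint k) : 1 ≤ k.re := by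
  rcases hk with ⟨n, rfl⟩ | ⟨j, rfl⟩
  · simp
  · rw [← ofReal_intCast]
    rw [add_re, div_ofReal_re]
    simp

theorem IsTrivialVarphiPoint.varphi_eq_zero {k : ℂ} (hk : IsTrivialVarphiPoint k) :
    varphi k = 0 := by
  rcases hk with ⟨n, rfl⟩ | h
  · rcases n with _ | n
    -- At `k = 1` the zero comes from `1 - 2^(k-1)`, since `ζ(0) ≠ 0`.
    · rw [varphi_eq (by simp)]; simp
    · rw [varphi_eq (by norm_cast), show 1 - (2 * ((n + 1 : ℕ) : ℂ) + 1) = -2 * ((n : ℂ) + 1) by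
        push_cast; ring, riemannZeta_neg_two_mul_nat_add_one, mul_zero]
  · rcases eq_or_ne k 0 with rfl | hk0
    · exact absurd (one_le_re (Or.inr h)) (by simp)
    · rw [varphi_eq hk0, one_sub_two_cpow_eq_zero_iff.2 h, mul_zero, zero_mul]

theorem isNontrivialVarphiZero_iff {k : ℂ} :
    IsNontrivialVarphiZero k ↔ varphi k = 0 ∧ 0 < k.re ∧ k.re < 1 := by
  refine ⟨fun ⟨h0, hn⟩ ↦ ⟨h0, ?_⟩, fun ⟨h0, _, h2⟩ ↦ ⟨h0, fun h ↦ ?_⟩⟩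
  · have hk0 : k ≠ 0 := by
      rintro rfl
      simp [varphi_zero] at h0
    have h2 : 1 - (2 : ℂ) ^ (k - 1) ≠ 0 := fun h ↦ hn (Or.inr (one_sub_two_cpow_eq_zero_iff.1 h))
    rw [varphi_eq hk0] at h0
    have hz : riemannZeta (1 - k) = 0 := by simpa [hk0, h2] using h0
    have hnt : IsNontrivialZetaZero (1 - k) := by
      -- A trivial zero `1 - k = -2(n + 1)` of `ζ` would make `k` the odd integer `2(n + 1) + 1`,
      -- hence the index `n + 1`.
      refine ⟨fun h ↦ hk0 (by linear_combination -h), hz, fun ⟨n, h⟩ ↦ hn (Or.inl ⟨n + 1, ?_⟩)⟩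
      push_cast
      linear_combination -h
    have := isNontrivialZetaZero_iff.1 hnt
    simp only [sub_re, one_re] at this
    exact ⟨by linarith [this.2.2], by linarith [this.2.1]⟩
  · linarith [h.one_le_re]

/-- The first identity compares both functions at the same `k`, so no reflection of zeros is needed;
the zeros of `2^(1-k) - 1` lie on `Re k = 1`, and those of the cosine at odd integers. -/
theorem varphi_eq_zero_iff_riemannZeta_eq_zero {k : ℂ} (h0 : 0 < k.re) (h1 : k.re < 1) :
    varphi k = 0 ↔ riemannZeta k = 0 := by
  have hpi : (Real.pi : ℂ) ≠ 0 := ofReal_ne_zero.2 Real.pi_pos.ne'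
  have hk1 : k ≠ 1 := fun h ↦ by simp [h] at h1
  have hkn : ∀ n : ℕ, k ≠ -((n : ℂ) + 1) := by
    rintro n rfl
    simp at h0
    linarith [n.cast_nonneg (α := ℝ)]
  have hG : Gamma (k + 1) ≠ 0 := Gamma_ne_zero_of_re_pos (by simp; linarith)
  have hp : (Real.pi : ℂ) ^ (-k) ≠ 0 := by simp [cpow_eq_zero_iff, hpi]
  have h2 : (2 : ℂ) ^ (1 - k) - 1 ≠ 0 := by
    intro h
    have h3 : (2 : ℂ) ^ (1 - k) * 2 ^ (k - 1) = 1 := by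
      rw [← cpow_add _ _ two_ne_zero]; simp
    have h4 : IsTrivialVarphiPoint k := Or.inr <| one_sub_two_cpow_eq_zero_iff.1 <| by
      linear_combination (2 : ℂ) ^ (k - 1) * h - h3
    linarith [h4.one_le_re]
  have hcos : Complex.cos (Real.pi * k / 2) ≠ 0 := by
    intro h
    obtain ⟨m, hm⟩ := Complex.cos_eq_zero_iff.1 h
    have hkm : k = ((2 * m + 1 : ℤ) : ℝ) := by
      field_simp at hm
      push_cast
      linear_combination hm
    rw [hkm, ofReal_re] at h0 h1
    norm_cast at h0 h1
    omega
  rw [← varphi_eq_Gamma_mul hk1 hkn]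
  simp [hG, hp, h2, hcos]

theorem mainTheorem1 :
    -- the integral defining `φ` converges absolutely for every complex `k`, and `φ` is entire
    (∀ k : ℂ, MeasureTheory.IntegrableOn (varphiIntegrand k) (Set.Ioi (0 : ℝ))) ∧
    Differentiable ℂ varphi ∧
    -- the first identity, with `k! = Γ(k + 1)`, away from the negative integers and `1`
    (∀ k : ℂ, k ≠ 1 → (∀ n : ℕ, k ≠ -((n : ℂ) + 1)) →
      -2 * Complex.Gamma (k + 1) * ((2 : ℂ) ^ (1 - k) - 1) * (Real.pi : ℂ) ^ (-k) *
        Complex.cos ((Real.pi : ℂ) * k / 2) * riemannZeta k = varphi k) ∧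
    -- the second identity, away from the pole of zeta
    (∀ k : ℂ, k ≠ 1 →
      2 * (k - 1) * (1 - (2 : ℂ) ^ (-k)) * riemannZeta k = varphi (1 - k)) ∧
    -- the trivial zeros of `φ` are zeros of `φ`
    (∀ k : ℂ, IsTrivialVarphiPoint k → varphi k = 0) ∧
    -- the non-trivial zeros of zeta and of `φ` coincide
    (∀ k : ℂ, IsNontrivialZetaZero k ↔ IsNontrivialVarphiZero k) ∧
    -- the non-trivial zeros of `φ` are its zeros in the open critical strip
    (∀ k : ℂ, IsNontrivialVarphiZero k ↔ varphi k = 0 ∧ 0 < k.re ∧ k.re < 1) ∧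
    -- the Riemann hypothesis in terms of `φ`
    (RiemannHypothesis ↔ ∀ k : ℂ, varphi k = 0 → 0 < k.re → k.re < 1 → k.re = 1 / 2) := by
  refine ⟨integrableOn_varphiIntegrand, differentiable_varphi, fun k ↦ varphi_eq_Gamma_mul,
    fun k ↦ varphi_one_sub, fun k ↦ IsTrivialVarphiPoint.varphi_eq_zero, fun k ↦ ?_,
    fun k ↦ isNontrivialVarphiZero_iff, fun h k h0 h1 h2 ↦ ?_, fun h k h0 hn hk1 ↦ ?_⟩
  · rw [isNontrivialZetaZero_iff, isNontrivialVarphiZero_iff]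
    exact and_congr_left fun ⟨h1, h2⟩ ↦ (varphi_eq_zero_iff_riemannZeta_eq_zero h1 h2).symm
  · have hz := (varphi_eq_zero_iff_riemannZeta_eq_zero h1 h2).1 h0
    obtain ⟨hk1, -, hn⟩ := isNontrivialZetaZero_iff.2 ⟨hz, h1, h2⟩
    exact h k hz hn hk1
  · obtain ⟨-, h1, h2⟩ := isNontrivialZetaZero_iff.1 ⟨hk1, h0, hn⟩
    exact h k ((varphi_eq_zero_iff_riemannZeta_eq_zero h1 h2).2 h0) h1 h2
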